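/- Let $X$ be a Fano manifold of dimension $n$, i.e. a compact complex manifold whose anti-canonical line bundle $-K_X=\Lambda^nTX$ carries a smooth metric of positive curvature. Metrics on line bundles are written additively: a smooth metric $\phi$ on $-K_X$ is locally a smooth real function with $|s|_{\phi}^2=|s|^2e^{-\phi}$, $k\phi$ is the induced metric on $-kK_X=(-K_X)^{\otimes k}$, and $e^{-\phi}$ also denotes the volume form on $X$ whose density in local holomorphic coordinates $z_1,\dots,z_n$, with respect to Lebesgue measure, is $e^{-\phi}$, where $\phi$ is represented in the trivialization $\partial/\partial z_1\wedge\dots\wedge\partial/\partial z_n$. Let $k$ be a positive integer such that $N=N_k:=\dim H^0(X,-kK_X)\ge 1$. For a smooth metric $\phi$ on $-K_X$ and a volume form $\mu$ on $X$, let $H^{(k)}(\phi,\mu)(s,t):=\int_X\langle s,t\rangle_{k\phi}\,\mu$ be the $L^2$ Hermitian metric on $H^0(X,-kK_X)$. Fix a smooth metric $\psi_0$ of positive curvature on $-K_X$ and a basis $s_1,\dots,s_N$ of $H^0(X,-kK_X)$ which is orthonormal for $H^{(k)}(\psi_0,e^{-\psi_0})$. Write $\det H^{(k)}(\phi,\mu)$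 for the determinant of the matrix $\big(H^{(k)}(\phi,\mu)(s_i,s_j)\big)_{i,j}$, and let $\det S^{(k)}(x_1,\dots,x_N):=\det(s_i(x_j))$, a holomorphic section of $-kK_{X^N}$ over $X^N$. Let $\phi_0$ be a smooth metric on $-K_X$ and let $\gamma>0$. Set $$\mathcal Z_{N}(-\gamma):=\int_{X^{N}}\big\|\det S^{(k)}\big\|_{k\phi_0}^{-2\gamma/k}\,(e^{-\phi_0})^{\otimes N}\in(0,\infty],$$ and, for every smooth metric $\phi$ on $-K_X$ (of arbitrary curvature), $$\mathcal D_{k,-\gamma}(\phi):=\frac{1}{N(k+\gamma)}\log\det H^{(k)}\big(\phi,e^{-(\gamma\phi+(1-\gamma)\phi_0)}\big)-\frac1\gamma\log\int_Xe^{-(\gamma\phi+(1-\gamma)\phi_0)}.$$ Then $$-\frac{1}{\gamma N}\log\mathcal Z_{N}(-\gamma)\le\Big(1+\frac{\gamma}{k}\Big)\inf_{\phi}\mathcal D_{k,-\gamma}(\phi)+\frac{1}{kN}\log (N!),$$ where the infimum runs over all smooth metrics $\phi$ on $-K_X$. The inequality is understood in $[-\infty,\infty]$; the left-hand side is $-\infty$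 if $\mathcal Z_N(-\gamma)=\infty$. -/

import Mathlib

open MeasureTheory
open scoped ContDiff Manifold ENNReal

noncomputable section

namespace Fano

/-- The complex Jacobian determinant `det (∂w/∂z)` at the point `x` of the change of holomorphic
coordinates from the chart `e` (coordinates `z`) to the chart `f` (coordinates `w`). -/
def jacobian {n : ℕ} {X : Type*} [TopologicalSpace X] [ChartedSpace (Fin n → ℂ) X]
    (e f : atlas (Fin n → ℂ) X) (x : X) : ℂ :=
  (fderiv ℂ (fun z => f.1 (e.1.symm z)) (e.1 x)).det

/-- The space `H⁰(X, -kK_X)` of global holomorphic sections of the `k`-th tensor power of the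
anti-canonical line bundle `-K_X = Λⁿ TX`, described in local trivializations.

A section `s` is given by its coefficients: `s e x` is the coefficient of `s(x)` with respect to
the frame `(∂/∂z₁ ∧ ⋯ ∧ ∂/∂zₙ)^{⊗ k}` attached to the chart `e`, for `x` in the domain of `e`
(and, by convention, `s e x = 0` for `x` outside the domain of `e`).
Since `∂/∂z₁ ∧ ⋯ ∧ ∂/∂zₙ = det (∂w/∂z) ∂/∂w₁ ∧ ⋯ ∧ ∂/∂wₙ`, the coefficients for two charts
are related by the factor `det (∂w/∂z) ^ k`. -/
def sections (n k : ℕ) (X : Type*) [TopologicalSpace X] [ChartedSpace (Fin n → ℂ) X] :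
    Submodule ℂ (atlas (Fin n → ℂ) X → X → ℂ) where
  carrier := {s |
    (∀ e, ∀ x ∉ e.1.source, s e x = 0) ∧
    (∀ e f, ∀ x ∈ e.1.source ∩ f.1.source, s f x = jacobian e f x ^ k * s e x) ∧
    (∀ e, DifferentiableOn ℂ (fun z => s e (e.1.symm z)) e.1.target)}
  add_mem' := by
    rintro s t ⟨hs₀, hs₁, hs₂⟩ ⟨ht₀, ht₁, ht₂⟩
    refine ⟨fun e x hx => ?_, fun e f x hx => ?_, fun e => (hs₂ e).add (ht₂ e)⟩
    · simp [hs₀ e x hx, ht₀ e x hx]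
    · simp only [Pi.add_apply, hs₁ e f x hx, ht₁ e f x hx]
      ring
  zero_mem' := by
    refine ⟨fun e x _ => rfl, fun e f x _ => by simp, fun e => differentiableOn_const 0⟩
  smul_mem' := by
    rintro c s ⟨hs₀, hs₁, hs₂⟩
    refine ⟨fun e x hx => ?_, fun e f x hx => ?_, fun e => (hs₂ e).const_smul c⟩
    · simp [hs₀ e x hx]
    · simp only [Pi.smul_apply, smul_eq_mul, hs₁ e f x hx]
      ring

/-- A smooth (Hermitian) metric `φ` on the anti-canonical line bundle `-K_X`, in additive notation:
`φ.weight e` is the local weight of `φ` in the trivialization `∂/∂z₁ ∧ ⋯ ∧ ∂/∂zₙ` of `-K_X`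
attached to the chart `e`, so that `|s|²_φ = |s|² exp (-φ)` on the domain of `e`. The values of
`φ.weight e` outside the domain of `e` are irrelevant. -/
structure SmoothMetric (n : ℕ) (X : Type*) [TopologicalSpace X] [ChartedSpace (Fin n → ℂ) X] where
  weight : atlas (Fin n → ℂ) X → X → ℝ
  weight_eq : ∀ e f, ∀ x ∈ e.1.source ∩ f.1.source,
    weight f x = weight e x + Real.log (‖jacobian e f x‖ ^ 2)
  smooth : ∀ e, ContDiffOn ℝ ∞ (fun z => weight e (e.1.symm z)) e.1.target

section

variable {n : ℕ} {X : Type*} [TopologicalSpace X] [ChartedSpace (Fin n → ℂ) X]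

/-- Positivity of the curvature `dd^c φ`: in every chart the complex Hessian of the local weight is
positive definite. For a real function `u` of class `C²` on `ℂⁿ`,
`D²u(v, v) + D²u(iv, iv) = 4 ∑ⱼₗ (∂²u/∂zⱼ∂z̄ₗ) vⱼ v̄ₗ`. -/
def SmoothMetric.HasPositiveCurvature (φ : SmoothMetric n X) : Prop :=
  ∀ e : atlas (Fin n → ℂ) X, ∀ z ∈ e.1.target, ∀ v : Fin n → ℂ, v ≠ 0 →
    0 < iteratedFDeriv ℝ 2 (fun w => φ.weight e (e.1.symm w)) z ![v, v]
      + iteratedFDeriv ℝ 2 (fun w => φ.weight e (e.1.symm w)) z ![Complex.I • v, Complex.I • v]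

/-- The metric `γ φ + (1 - γ) φ₀` on `-K_X`. -/
def SmoothMetric.twist (γ : ℝ) (φ φ₀ : SmoothMetric n X) : SmoothMetric n X where
  weight e x := γ * φ.weight e x + (1 - γ) * φ₀.weight e x
  weight_eq e f x hx := by
    rw [φ.weight_eq e f x hx, φ₀.weight_eq e f x hx]
    ring
  smooth e := (contDiffOn_const.mul (φ.smooth e)).add (contDiffOn_const.mul (φ₀.smooth e))

/-- The measure on `X` defined by the volume form `exp (-φ)`. In the chart `e` it has density
`exp (-φ.weight e)` with respect to Lebesgue measure in the coordinates `z₁, …, zₙ`. It is the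
least measure on `X` that dominates these local measures. (As they agree on overlaps of charts,
its restriction to the domain of `e` is the local measure of `e`.) -/
def SmoothMetric.volumeForm [MeasurableSpace X] (φ : SmoothMetric n X) : Measure X :=
  ⨆ e : atlas (Fin n → ℂ) X,
    (((volume : Measure (Fin n → ℂ)).restrict e.1.target).withDensity
      fun z => ENNReal.ofReal (Real.exp (-φ.weight e (e.1.symm z)))).map e.1.symm

/-- The chart at `x`, as an element of the atlas. -/
def chart (x : X) : atlas (Fin n → ℂ) X := ⟨chartAt (Fin n → ℂ) x, chart_mem_atlas _ x⟩

/-- The pointwise Hermitian product `⟨s, t⟩_{kφ}` of two sections of `-kK_X`, that is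
`s t̄ exp (-kφ)` in any local trivialization (computed here in the one of the chart at `x`), so
that `⟨s, s⟩_{kφ} = |s|²_{kφ}`. -/
def pairing {k : ℕ} (φ : SmoothMetric n X) (s t : sections n k X) (x : X) : ℂ :=
  s.1 (chart x) x * (starRingEnd ℂ) (t.1 (chart x) x)
    * (Real.exp (-(k * φ.weight (chart x) x)) : ℂ)

/-- The Hermitian form `H^{(k)}(φ, μ)(s, t) = ∫_X ⟨s, t⟩_{kφ} μ` on `H⁰(X, -kK_X)`. -/
def hermitianForm {k : ℕ} [MeasurableSpace X] (φ : SmoothMetric n X) (μ : Measure X)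
    (s t : sections n k X) : ℂ :=
  ∫ x, pairing φ s t x ∂μ

/-- The determinant of `H^{(k)}(φ, μ)`, identified with the Hermitian matrix of the
`H^{(k)}(φ, μ)(sᵢ, sⱼ)` in the basis `(sᵢ)`; it is a real number. -/
def detHermitian {k N : ℕ} [MeasurableSpace X] (s : Module.Basis (Fin N) ℂ (sections n k X))
    (φ : SmoothMetric n X) (μ : Measure X) : ℝ :=
  (Matrix.det (Matrix.of fun i j => hermitianForm φ μ (s i) (s j))).re

/-- The pointwise norm `‖det S^{(k)}‖_{kφ}` at `(x₁, …, x_N)` of the Slater determinant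
`det (sᵢ(xⱼ))`, a section of `-kK_{X^N}` over `X^N` (computed in the trivializations of the charts
at the `xⱼ`), with respect to the metric on `-kK_{X^N}` induced by `φ`. -/
def slaterNorm {k N : ℕ} (s : Module.Basis (Fin N) ℂ (sections n k X)) (φ : SmoothMetric n X)
    (x : Fin N → X) : ℝ :=
  ‖Matrix.det (Matrix.of fun i j => (s i).1 (chart (x j)) (x j))‖
    * ∏ j, Real.exp (-(k * φ.weight (chart (x j)) (x j)) / 2)

/-- The partition function `Z_N(β) = ∫_{X^N} ‖det S^{(k)}‖_{kφ₀}^{2β/k} (exp (-φ₀))^{⊗ N}`, with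
values in `[0, ∞]` (a negative power of `0` being `∞`). -/
def partitionFunction {k N : ℕ} [MeasurableSpace X]
    (s : Module.Basis (Fin N) ℂ (sections n k X)) (φ₀ : SmoothMetric n X) (β : ℝ) : ℝ≥0∞ :=
  ∫⁻ x : Fin N → X, ENNReal.ofReal (slaterNorm s φ₀ x) ^ (2 * β / k)
    ∂(Measure.pi fun _ => φ₀.volumeForm)

/-- The functional
`L_k(φ) = - (1 / (N (k + γ))) log det H^{(k)}(φ, exp (-(γ φ + (1 - γ) φ₀)))`. -/
def functionalL {k N : ℕ} [MeasurableSpace X] (s : Module.Basis (Fin N) ℂ (sections n k X))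
    (φ₀ : SmoothMetric n X) (γ : ℝ) (φ : SmoothMetric n X) : ℝ :=
  -(1 / (N * (k + γ))) * Real.log (detHermitian s φ (SmoothMetric.twist γ φ φ₀).volumeForm)

/-- The functional
`D_{k,-γ}(φ) = - L_k(φ) - (1/γ) log ∫_X exp (-(γ φ + (1 - γ) φ₀))`. -/
def functionalD {k N : ℕ} [MeasurableSpace X] (s : Module.Basis (Fin N) ℂ (sections n k X))
    (φ₀ : SmoothMetric n X) (γ : ℝ) (φ : SmoothMetric n X) : ℝ :=
  -functionalL s φ₀ γ φ
    - 1 / γ * Real.log ((SmoothMetric.twist γ φ φ₀).volumeForm.real Set.univ)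

end

end Fano

end

/-!
The partition function bounds the functional `D` by Hölder's inequality on `X^N`.

Write `p = γ / k`, `μ = exp (-(γ φ + (1 - γ) φ₀))` and `M = μ(X)`. Passing from `φ₀` to `φ` multiplies
`‖det S‖^{-2γ/k}` by `exp (γ (φ - φ₀))` in each variable; this factor is absorbed by replacing
`exp (-φ₀)` with `μ = exp (-γ (φ - φ₀)) exp (-φ₀)`, so that
`Z = ∫ ‖det S‖_{kφ}^{-2p} μ^{⊗ N}`. On the other hand `∫ ‖det S‖²_{kφ} μ^{⊗ N} = N! det H(φ, μ)` by
Andréief's identity (`Fano.integral_slaterNorm_sq`). Hölder's inequality for the powers `-p` and `1`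
of `‖det S‖²_{kφ}` gives `M^{N (1 + p)} ≤ Z (N! det H(φ, μ))^p` (`Fano.volume_pow_le`), and the claim
is the logarithm of this inequality. If `Z = ∞` there is nothing to prove; if `Z < ∞`, the inequality
itself shows that `Z` and `det H(φ, μ)` are positive, since `0 < M < ∞`.

The geometric input is that the volume forms are finite nonzero measures and that pointwise Hermitian
products are continuous functions on `X`. The measure of a volume form is a supremum over all charts
of an atlas that may be uncountable; it is finite because the local measures agree on overlaps
(`Fano.SmoothMetric.localVolume_eq`) and finitely many coordinate neighbourhoods cover `X`. On `X^N`
the squared norm of the Slater determinant is handled as a polynomial in the pairings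
`⟨sᵢ, sⱼ⟩_{kφ}(x)` (`Fano.slaterNorm_sq`), which do not depend on the choice of charts. The identity
for `μ^{⊗ N}` is never needed: all integrals over `X^N` are taken against `exp (-φ₀)^{⊗ N}` with the
density written out.
-/

/-! ### Two general facts -/

/-- Multiplication by a positive finite density commutes with suprema of measures, since it is an
order isomorphism. -/
theorem MeasureTheory.Measure.iSup_withDensity {α ι : Type*} [MeasurableSpace α]
    (μ : ι → Measure α) {g : α → ℝ≥0∞} (hg : Measurable g) (h0 : ∀ x, g x ≠ 0)
    (htop : ∀ x, g x ≠ ⊤) : ⨆ i, (μ i).withDensity g = (⨆ i, μ i).withDensity g := by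
  have mono : ∀ {μ ν : Measure α} (f : α → ℝ≥0∞), μ ≤ ν → μ.withDensity f ≤ ν.withDensity f := by
    intro μ ν f h
    refine Measure.le_iff.2 fun s hs => ?_
    rw [withDensity_apply _ hs, withDensity_apply _ hs]
    exact lintegral_mono' (Measure.restrict_mono subset_rfl h) le_rfl
  have cancel : ∀ (ν : Measure α) (f : α → ℝ≥0∞), Measurable f → (∀ x, f x ≠ 0) →
      (∀ x, f x ≠ ⊤) → (ν.withDensity f).withDensity f⁻¹ = ν := by
    intro ν f hf h0 htop
    exact withDensity_inv_same hf (.of_forall h0) (.of_forall htop)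
  refine le_antisymm (iSup_le fun i => mono g (le_iSup μ i)) ?_
  have h : ⨆ i, μ i ≤ (⨆ i, (μ i).withDensity g).withDensity g⁻¹ := iSup_le fun i => by
    conv_lhs => rw [← cancel (μ i) g hg h0 htop]
    exact mono _ (le_iSup (fun i => (μ i).withDensity g) i)
  refine (mono g h).trans_eq ?_
  have := cancel (⨆ i, (μ i).withDensity g) g⁻¹ hg.inv (by simpa using htop) (by simpa using h0)
  rwa [inv_inv] at this

/-- The combinatorial core of Andréief's identity. -/
theorem Matrix.sum_perm_sum_perm_prod {m R : Type*} [Fintype m] [DecidableEq m] [CommRing R]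
    (H : Matrix m m R) :
    ∑ σ : Equiv.Perm m, ∑ τ : Equiv.Perm m,
        ((Equiv.Perm.sign σ : ℤ) : R) * ((Equiv.Perm.sign τ : ℤ) : R) * ∏ j, H (σ j) (τ j)
      = (Fintype.card m).factorial * H.det := by
  have h : ∀ σ : Equiv.Perm m, ∑ τ : Equiv.Perm m,
      ((Equiv.Perm.sign σ : ℤ) : R) * ((Equiv.Perm.sign τ : ℤ) : R) * ∏ j, H (σ j) (τ j)
        = H.det := by
    intro σ
    have h1 := Matrix.det_permute' σ H.transpose
    rw [Matrix.det_transpose, Matrix.det_apply'] at h1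
    simp only [Matrix.submatrix_apply, Matrix.transpose_apply, id] at h1
    simp only [mul_assoc]
    rw [← Finset.mul_sum, h1, ← mul_assoc, ← Int.cast_mul, ← Units.val_mul, Int.units_mul_self]
    simp
  simp only [h, Finset.sum_const, Finset.card_univ, Fintype.card_perm, nsmul_eq_mul]

/-! ### Changes of charts -/

namespace Fano

section ChangeOfCharts

variable {n : ℕ} {X : Type*} [TopologicalSpace X] [ChartedSpace (Fin n → ℂ) X]

theorem differentiableAt_transition [IsManifold 𝓘(ℂ, Fin n → ℂ) ω X]
    (e f : atlas (Fin n → ℂ) X) {x : X}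
    (hx : x ∈ e.1.source ∩ f.1.source) :
    DifferentiableAt ℂ (fun z => f.1 (e.1.symm z)) (e.1 x) := by
  have he := contMDiffOn_symm_of_mem_maximalAtlas (I := 𝓘(ℂ, Fin n → ℂ)) (n := ω)
    (IsManifold.subset_maximalAtlas e.2)
  have hf := contMDiffOn_of_mem_maximalAtlas (I := 𝓘(ℂ, Fin n → ℂ)) (n := ω)
    (IsManifold.subset_maximalAtlas f.2)
  have hfe := contMDiffOn_iff_contDiffOn.1 (hf.comp' he)
  refine (hfe.contDiffAt ?_).differentiableAt (by simp)
  refine (e.1.symm.isOpen_inter_preimage f.1.open_source).mem_nhds ?_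
  simp [e.1.map_source hx.1, e.1.left_inv hx.1, hx.2]

/-- By the chain rule, the Jacobians of a change of coordinates and of its inverse are inverse to
each other. -/
theorem jacobian_mul_jacobian [IsManifold 𝓘(ℂ, Fin n → ℂ) ω X]
    (e f : atlas (Fin n → ℂ) X) {x : X}
    (hx : x ∈ e.1.source ∩ f.1.source) : jacobian f e x * jacobian e f x = 1 := by
  have h1 := (differentiableAt_transition e f hx).hasFDerivAt
  have h2 := (differentiableAt_transition f e hx.symm).hasFDerivAt
  have h2' : HasFDerivAt (fun z => e.1 (f.1.symm z))
      (fderiv ℂ (fun z => e.1 (f.1.symm z)) (f.1 x)) (f.1 (e.1.symm (e.1 x))) := by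
    rwa [e.1.left_inv hx.1]
  have h3 := h2'.comp (e.1 x) h1
  have h4 : HasFDerivAt (fun z : Fin n → ℂ => z) (ContinuousLinearMap.id ℂ _) (e.1 x) :=
    hasFDerivAt_id _
  have hev : ((fun z => e.1 (f.1.symm z)) ∘ fun z => f.1 (e.1.symm z))
      =ᶠ[nhds (e.1 x)] fun z => z := by
    have : e.1.target ∩ e.1.symm ⁻¹' f.1.source ∈ nhds (e.1 x) := by
      refine (e.1.symm.isOpen_inter_preimage f.1.open_source).mem_nhds ?_
      simp [e.1.map_source hx.1, e.1.left_inv hx.1, hx.2]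
    filter_upwards [this] with z hz
    simp [f.1.left_inv hz.2, e.1.right_inv hz.1]
  have h5 := h3.unique (h4.congr_of_eventuallyEq hev)
  have h6 := congrArg (fun L : (Fin n → ℂ) →L[ℂ] (Fin n → ℂ) => LinearMap.det L.toLinearMap) h5
  simpa [jacobian, ContinuousLinearMap.det] using h6

theorem jacobian_ne_zero [IsManifold 𝓘(ℂ, Fin n → ℂ) ω X]
    (e f : atlas (Fin n → ℂ) X) {x : X}
    (hx : x ∈ e.1.source ∩ f.1.source) : jacobian e f x ≠ 0 :=
  right_ne_zero_of_mul_eq_one (jacobian_mul_jacobian e f hx)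

/-- The transformation rule of the weights, in exponential form. -/
theorem SmoothMetric.exp_neg_weight [IsManifold 𝓘(ℂ, Fin n → ℂ) ω X]
    (φ : SmoothMetric n X) (e f : atlas (Fin n → ℂ) X) {x : X}
    (hx : x ∈ e.1.source ∩ f.1.source) :
    Real.exp (-φ.weight e x) = ‖jacobian e f x‖ ^ 2 * Real.exp (-φ.weight f x) := by
  have hJ : 0 < ‖jacobian e f x‖ ^ 2 := by
    have := norm_pos_iff.2 (jacobian_ne_zero e f hx)
    positivity
  rw [φ.weight_eq e f x hx, neg_add, Real.exp_add, Real.exp_neg (Real.log _), Real.exp_log hJ]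
  rw [mul_left_comm, mul_inv_cancel₀ hJ.ne', mul_one]

theorem mem_source_chart (x : X) : x ∈ (chart (n := n) x).1.source := mem_chart_source _ x

theorem SmoothMetric.continuousOn_weight (φ : SmoothMetric n X) (e : atlas (Fin n → ℂ) X) :
    ContinuousOn (φ.weight e) e.1.source := by
  refine ((φ.smooth e).continuousOn.comp e.1.continuousOn e.1.mapsTo).congr fun x hx => ?_
  simp [e.1.left_inv hx]

theorem continuousOn_section {k : ℕ} (s : sections n k X) (e : atlas (Fin n → ℂ) X) :
    ContinuousOn (s.1 e) e.1.source := by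
  refine ((s.2.2.2 e).continuousOn.comp e.1.continuousOn e.1.mapsTo).congr fun x hx => ?_
  simp [e.1.left_inv hx]

theorem pairing_eq [IsManifold 𝓘(ℂ, Fin n → ℂ) ω X]
    {k : ℕ} (φ : SmoothMetric n X) (s t : sections n k X)
    (e : atlas (Fin n → ℂ) X) {x : X} (hx : x ∈ e.1.source) :
    pairing φ s t x
      = s.1 e x * (starRingEnd ℂ) (t.1 e x) * (Real.exp (-(k * φ.weight e x)) : ℂ) := by
  have hx' : x ∈ e.1.source ∩ (chart (n := n) x).1.source := ⟨hx, mem_source_chart x⟩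
  have hexp : ∀ f : atlas (Fin n → ℂ) X,
      Real.exp (-(k * φ.weight f x)) = Real.exp (-φ.weight f x) ^ k := fun f => by
    rw [← Real.exp_nat_mul]; ring_nf
  rw [pairing, s.2.2.1 e _ x hx', t.2.2.1 e _ x hx', hexp, hexp, φ.exp_neg_weight e _ hx']
  push_cast
  rw [← Complex.mul_conj', map_mul, map_pow]
  ring

theorem continuous_pairing [IsManifold 𝓘(ℂ, Fin n → ℂ) ω X]
    {k : ℕ} (φ : SmoothMetric n X) (s t : sections n k X) :
    Continuous (pairing φ s t) := by
  refine continuous_iff_continuousAt.2 fun x => ?_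
  set e := chart (n := n) x
  have hx : x ∈ e.1.source := mem_source_chart x
  have hc : ContinuousOn (fun x => s.1 e x * (starRingEnd ℂ) (t.1 e x)
      * (Real.exp (-(k * φ.weight e x)) : ℂ)) e.1.source := by
    refine ((continuousOn_section s e).mul
      (Complex.continuous_conj.comp_continuousOn (continuousOn_section t e))).mul ?_
    exact Complex.continuous_ofReal.comp_continuousOn (Real.continuous_exp.comp_continuousOn
      ((continuousOn_const.mul (φ.continuousOn_weight e)).neg))
  exact (hc.congr fun y hy => pairing_eq φ s t e hy).continuousAt (e.1.open_source.mem_nhds hx)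

/-- The difference `φ - φ₀` of two metrics is a function on `X`. -/
noncomputable def SmoothMetric.diff (φ φ₀ : SmoothMetric n X) (x : X) : ℝ :=
  φ.weight (chart x) x - φ₀.weight (chart x) x

theorem SmoothMetric.diff_eq (φ φ₀ : SmoothMetric n X) (e : atlas (Fin n → ℂ) X) {x : X}
    (hx : x ∈ e.1.source) : φ.diff φ₀ x = φ.weight e x - φ₀.weight e x := by
  have hx' : x ∈ e.1.source ∩ (chart (n := n) x).1.source := ⟨hx, mem_source_chart x⟩
  rw [diff, φ.weight_eq e _ x hx', φ₀.weight_eq e _ x hx']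
  ring

theorem SmoothMetric.continuous_diff (φ φ₀ : SmoothMetric n X) : Continuous (φ.diff φ₀) := by
  refine continuous_iff_continuousAt.2 fun x => ?_
  set e := chart (n := n) x
  have hx : x ∈ e.1.source := mem_source_chart x
  exact (((φ.continuousOn_weight e).sub (φ₀.continuousOn_weight e)).congr
    fun y hy => φ.diff_eq φ₀ e hy).continuousAt (e.1.open_source.mem_nhds hx)

end ChangeOfCharts

/-! ### The measure of a volume form -/

section VolumeForm

variable {n : ℕ} {X : Type*} [TopologicalSpace X] [ChartedSpace (Fin n → ℂ) X]

theorem SmoothMetric.aemeasurable_density (φ : SmoothMetric n X) (e : atlas (Fin n → ℂ) X) :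
    AEMeasurable (fun z => ENNReal.ofReal (Real.exp (-φ.weight e (e.1.symm z))))
      ((volume : Measure (Fin n → ℂ)).restrict e.1.target) :=
  (Real.measurable_exp.comp_aemeasurable
    ((φ.smooth e).continuousOn.aemeasurable e.1.open_target.measurableSet).neg).ennreal_ofReal

variable [MeasurableSpace X]

/-- The measure on `X`, carried by the domain of the chart `e`, given by `exp (-φ)` in the
coordinates of `e`. -/
noncomputable def SmoothMetric.localVolume (φ : SmoothMetric n X) (e : atlas (Fin n → ℂ) X) :
    Measure X :=
  (((volume : Measure (Fin n → ℂ)).restrict e.1.target).withDensity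
    fun z => ENNReal.ofReal (Real.exp (-φ.weight e (e.1.symm z)))).map e.1.symm

theorem SmoothMetric.localVolume_le_volumeForm (φ : SmoothMetric n X)
    (e : atlas (Fin n → ℂ) X) : φ.localVolume e ≤ φ.volumeForm :=
  le_iSup φ.localVolume e

variable [BorelSpace X]

theorem aemeasurable_chart_symm (e : atlas (Fin n → ℂ) X) :
    AEMeasurable e.1.symm ((volume : Measure (Fin n → ℂ)).restrict e.1.target) :=
  e.1.continuousOn_symm.aemeasurable e.1.open_target.measurableSet

theorem measurableSet_target_inter_preimage (e : atlas (Fin n → ℂ) X) {A : Set X}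
    (hA : MeasurableSet A) : MeasurableSet (e.1.target ∩ e.1.symm ⁻¹' A) := by
  have h := (continuousOn_iff_continuous_domRestrict.1 e.1.continuousOn_symm).measurable hA
  have := e.1.open_target.measurableSet.subtype_image h
  rwa [Set.domRestrict_eq, Set.preimage_comp, Subtype.image_preimage_coe] at this

theorem SmoothMetric.localVolume_apply (φ : SmoothMetric n X) (e : atlas (Fin n → ℂ) X)
    {A : Set X} (hA : MeasurableSet A) :
    φ.localVolume e A = ∫⁻ z in e.1.target ∩ e.1.symm ⁻¹' A,
      ENNReal.ofReal (Real.exp (-φ.weight e (e.1.symm z))) := by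
  rw [localVolume, Measure.map_apply_of_aemeasurable
    ((aemeasurable_chart_symm e).mono_ac (withDensity_absolutelyContinuous _ _)) hA,
    withDensity_apply', Measure.restrict_restrict' e.1.open_target.measurableSet, Set.inter_comm]

theorem SmoothMetric.localVolume_source_inter (φ : SmoothMetric n X) (e : atlas (Fin n → ℂ) X)
    {A : Set X} (hA : MeasurableSet A) :
    φ.localVolume e (e.1.source ∩ A) = φ.localVolume e A := by
  rw [φ.localVolume_apply e hA,
    φ.localVolume_apply e (e.1.open_source.measurableSet.inter hA)]
  congr 2
  ext z
  simp only [Set.mem_inter_iff, Set.mem_preimage]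
  exact ⟨fun h => ⟨h.1, h.2.2⟩, fun h => ⟨h.1, e.1.map_target h.1, h.2⟩⟩

/-- The local measures of two charts agree on the overlap, by the change of variables formula: the
real Jacobian of a holomorphic map is the squared modulus of the complex one, which is the factor
relating the two densities. -/
theorem SmoothMetric.localVolume_eq [IsManifold 𝓘(ℂ, Fin n → ℂ) ω X] (φ : SmoothMetric n X)
    (e f : atlas (Fin n → ℂ) X) {A : Set X}
    (hA : MeasurableSet A) (hAe : A ⊆ e.1.source) (hAf : A ⊆ f.1.source) :
    φ.localVolume e A = φ.localVolume f A := by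
  rw [φ.localVolume_apply e hA, φ.localVolume_apply f hA]
  have himage : (fun z => f.1 (e.1.symm z)) '' (e.1.target ∩ e.1.symm ⁻¹' A)
      = f.1.target ∩ f.1.symm ⁻¹' A := by
    ext w
    constructor
    · rintro ⟨z, ⟨_, hz⟩, rfl⟩
      exact ⟨f.1.map_source (hAf hz), by simpa [f.1.left_inv (hAf hz)] using hz⟩
    · rintro ⟨hw, hwA⟩
      exact ⟨e.1 (f.1.symm w), ⟨e.1.map_source (hAe hwA),
        by simpa [e.1.left_inv (hAe hwA)] using hwA⟩, by
          simp [e.1.left_inv (hAe hwA), f.1.right_inv hw]⟩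
  have hinj : Set.InjOn (fun z => f.1 (e.1.symm z)) (e.1.target ∩ e.1.symm ⁻¹' A) :=
    fun z hz w hw h => e.1.symm.injOn hz.1 hw.1 (f.1.injOn (hAf hz.2) (hAf hw.2) h)
  rw [← himage, lintegral_image_eq_lintegral_abs_det_fderiv_mul volume
    (measurableSet_target_inter_preimage e hA)
    (f' := fun z => (fderiv ℂ (fun z => f.1 (e.1.symm z)) z).restrictScalars ℝ) ?_ hinj]
  · refine setLIntegral_congr_fun (measurableSet_target_inter_preimage e hA) fun z hz => ?_
    have hx : e.1.symm z ∈ e.1.source ∩ f.1.source := ⟨hAe hz.2, hAf hz.2⟩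
    have hdet : ((fderiv ℂ (fun z => f.1 (e.1.symm z)) z).restrictScalars ℝ).det
        = ‖jacobian e f (e.1.symm z)‖ ^ 2 := by
      rw [jacobian, e.1.right_inv hz.1, ← Complex.normSq_eq_norm_sq]
      simp [ContinuousLinearMap.det, LinearMap.det_restrictScalars, Algebra.norm_complex_eq]
    simp only [hdet]
    rw [abs_of_nonneg (by positivity), ← ENNReal.ofReal_mul (by positivity), f.1.left_inv hx.2,
      φ.exp_neg_weight e f hx]
  · intro z hz
    have := (differentiableAt_transition e f (x := e.1.symm z) ⟨hAe hz.2, hAf hz.2⟩).hasFDerivAt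
    rw [e.1.right_inv hz.1] at this
    exact (this.restrictScalars ℝ).hasFDerivWithinAt

/-- Every point has a neighbourhood in its chart of finite local volume. -/
theorem SmoothMetric.exists_nhds_localVolume_lt_top (φ : SmoothMetric n X) (x : X) :
    ∃ U : Set X, IsOpen U ∧ x ∈ U ∧ U ⊆ (chart (n := n) x).1.source ∧
      φ.localVolume (chart x) U < ⊤ := by
  set e := chart (n := n) x
  have hx : x ∈ e.1.source := mem_source_chart x
  have hcont : ContinuousAt (fun z => φ.weight e (e.1.symm z)) (e.1 x) :=
    (φ.smooth e).continuousOn.continuousAt (e.1.open_target.mem_nhds (e.1.map_source hx))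
  obtain ⟨ε, hε, hball⟩ := Metric.eventually_nhds_iff_ball.1
    (hcont.eventually (lt_mem_nhds (show φ.weight e (e.1.symm (e.1 x)) - 1 < _ by linarith)))
  refine ⟨e.1.source ∩ e.1 ⁻¹' Metric.ball (e.1 x) ε,
    e.1.isOpen_inter_preimage Metric.isOpen_ball, ⟨hx, by simp [hε]⟩, Set.inter_subset_left, ?_⟩
  set c := φ.weight e (e.1.symm (e.1 x)) - 1
  have hm : MeasurableSet (e.1.source ∩ e.1 ⁻¹' Metric.ball (e.1 x) ε) :=
    (e.1.isOpen_inter_preimage Metric.isOpen_ball).measurableSet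
  have hsub : e.1.target ∩ e.1.symm ⁻¹' (e.1.source ∩ e.1 ⁻¹' Metric.ball (e.1 x) ε)
      ⊆ Metric.ball (e.1 x) ε := by
    rintro z ⟨hz, hz'⟩
    simpa [e.1.right_inv hz] using hz'.2
  rw [φ.localVolume_apply e hm]
  calc ∫⁻ z in e.1.target ∩ e.1.symm ⁻¹' (e.1.source ∩ e.1 ⁻¹' Metric.ball (e.1 x) ε),
        ENNReal.ofReal (Real.exp (-φ.weight e (e.1.symm z)))
      ≤ ∫⁻ _ in Metric.ball (e.1 x) ε, ENNReal.ofReal (Real.exp (-c)) := by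
        refine (setLIntegral_mono' (measurableSet_target_inter_preimage e hm) fun z hz => ?_).trans
          (lintegral_mono_set hsub)
        exact ENNReal.ofReal_le_ofReal (Real.exp_le_exp.2 (neg_le_neg (hball z (hsub hz)).le))
    _ < ⊤ := by
        rw [setLIntegral_const]
        exact ENNReal.mul_lt_top ENNReal.ofReal_lt_top measure_ball_lt_top

/-- On a compact manifold the volume is finite: it is at most the sum of the volumes of finitely
many coordinate neighbourhoods that cover `X`. -/
theorem SmoothMetric.isFiniteMeasure_volumeForm [CompactSpace X]
    [IsManifold 𝓘(ℂ, Fin n → ℂ) ω X] (φ : SmoothMetric n X) : IsFiniteMeasure φ.volumeForm := by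
  choose U hUo hxU hUs hUfin using φ.exists_nhds_localVolume_lt_top
  obtain ⟨t, -, ht⟩ := isCompact_univ.elim_nhds_subcover U
    fun x _ => (hUo x).mem_nhds (hxU x)
  have hle : φ.volumeForm ≤ ∑ x ∈ t, (φ.localVolume (chart x)).restrict (U x) := by
    refine iSup_le (a := ∑ x ∈ t, (φ.localVolume (chart x)).restrict (U x)) fun e => ?_
    change φ.localVolume e ≤ _
    refine Measure.le_iff.2 fun A hA => ?_
    rw [Measure.finsetSum_apply]
    calc φ.localVolume e A = φ.localVolume e (e.1.source ∩ A) :=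
          (φ.localVolume_source_inter e hA).symm
      _ ≤ φ.localVolume e (⋃ x ∈ t, (e.1.source ∩ A) ∩ U x) := by
          refine measure_mono ?_
          rw [← Set.inter_iUnion₂]
          exact Set.subset_inter subset_rfl ((Set.subset_univ _).trans ht)
      _ ≤ ∑ x ∈ t, φ.localVolume e ((e.1.source ∩ A) ∩ U x) := measure_biUnion_finset_le _ _
      _ ≤ ∑ x ∈ t, ((φ.localVolume (chart x)).restrict (U x)) A := by
          refine Finset.sum_le_sum fun x _ => ?_
          rw [φ.localVolume_eq e (chart x)
            ((e.1.open_source.measurableSet.inter hA).inter (hUo x).measurableSet)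
            (Set.inter_subset_left.trans Set.inter_subset_left)
            (Set.inter_subset_right.trans (hUs x)), Measure.restrict_apply hA]
          exact measure_mono (Set.inter_subset_inter_left _ Set.inter_subset_right)
  refine ⟨(hle Set.univ).trans_lt ?_⟩
  rw [Measure.finsetSum_apply]
  exact ENNReal.sum_lt_top.2 fun x _ => by
    rw [Measure.restrict_apply_univ]; exact hUfin x

theorem SmoothMetric.volumeForm_univ_ne_zero [Nonempty X] (φ : SmoothMetric n X) :
    φ.volumeForm Set.univ ≠ 0 := by
  obtain ⟨x⟩ := ‹Nonempty X›
  intro h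
  have h0 : φ.localVolume (chart x) Set.univ = 0 :=
    le_antisymm ((φ.localVolume_le_volumeForm _ _).trans h.le) zero_le
  rw [φ.localVolume_apply _ MeasurableSet.univ, Set.preimage_univ, Set.inter_univ,
    lintegral_eq_zero_iff' (φ.aemeasurable_density _)] at h0
  have hne : (volume : Measure (Fin n → ℂ)).restrict (chart x).1.target ≠ 0 := by
    rw [Ne, Measure.restrict_eq_zero]
    exact ((chart (n := n) x).1.open_target.measure_pos volume
      ⟨_, (chart (n := n) x).1.map_source (mem_source_chart x)⟩).ne'
  have := ae_neBot.2 hne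
  obtain ⟨z, hz⟩ := h0.exists
  exact (ENNReal.ofReal_pos.2 (Real.exp_pos _)).ne' hz

/-- The volume form `exp (-(γ φ + (1 - γ) φ₀))` has density `exp (-γ (φ - φ₀))` with respect to
`exp (-φ₀)`. -/
theorem SmoothMetric.volumeForm_twist (γ : ℝ) (φ φ₀ : SmoothMetric n X) :
    (twist γ φ φ₀).volumeForm
      = φ₀.volumeForm.withDensity fun x => ENNReal.ofReal (Real.exp (-(γ * φ.diff φ₀ x))) := by
  have hg : Measurable fun x => ENNReal.ofReal (Real.exp (-(γ * φ.diff φ₀ x))) := by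
    have := (φ.continuous_diff φ₀).measurable
    fun_prop
  change ⨆ e, (twist γ φ φ₀).localVolume e = (⨆ e, φ₀.localVolume e).withDensity _
  rw [← Measure.iSup_withDensity _ hg (fun x => (ENNReal.ofReal_pos.2 (Real.exp_pos _)).ne')
    fun x => ENNReal.ofReal_ne_top]
  refine iSup_congr fun e => Measure.ext fun A hA => ?_
  have hsymm := (aemeasurable_chart_symm e).mono_ac (withDensity_absolutelyContinuous _
    fun z => ENNReal.ofReal (Real.exp (-φ₀.weight e (e.1.symm z))))
  have hA' := measurableSet_target_inter_preimage e hA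
  rw [withDensity_apply _ hA, SmoothMetric.localVolume_apply _ e hA, SmoothMetric.localVolume,
    ← lintegral_indicator hA, lintegral_map' (hg.indicator hA).aemeasurable hsymm]
  change _ = ∫⁻ a, ((A.indicator fun x => ENNReal.ofReal (Real.exp (-(γ * φ.diff φ₀ x))))
    ∘ e.1.symm) a ∂_
  rw [lintegral_withDensity_eq_lintegral_mul₀ (φ₀.aemeasurable_density e)
      ((hg.indicator hA).comp_aemeasurable (aemeasurable_chart_symm e)),
    ← lintegral_indicator hA', ← lintegral_indicator e.1.open_target.measurableSet]
  refine lintegral_congr fun z => ?_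
  by_cases hz : z ∈ e.1.target
  · by_cases hzA : e.1.symm z ∈ A
    · have hzS : z ∈ e.1.target ∩ e.1.symm ⁻¹' A := ⟨hz, hzA⟩
      simp only [Set.indicator_of_mem hzS, Set.indicator_of_mem hz, Pi.mul_apply,
        Function.comp_apply, Set.indicator_of_mem hzA]
      rw [← ENNReal.ofReal_mul (by positivity), ← Real.exp_add,
        φ.diff_eq φ₀ e (e.1.map_target hz), twist]
      congr 2
      ring
    · have hzS : z ∉ e.1.target ∩ e.1.symm ⁻¹' A := fun h => hzA h.2
      simp only [Set.indicator_of_notMem hzS, Set.indicator_of_mem hz, Pi.mul_apply,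
        Function.comp_apply, Set.indicator_of_notMem hzA, mul_zero]
  · have hzS : z ∉ e.1.target ∩ e.1.symm ⁻¹' A := fun h => hz h.1
    simp [Set.indicator_of_notMem hzS, Set.indicator_of_notMem hz]

end VolumeForm

/-! ### The Gram determinant of the Slater determinant -/

section Slater

variable {n : ℕ} {X : Type*} [TopologicalSpace X] [ChartedSpace (Fin n → ℂ) X] {k N : ℕ}

theorem nonempty_of_basis (s : Module.Basis (Fin N) ℂ (sections n k X)) (hN : 0 < N) :
    Nonempty X := by
  by_contra h
  have := not_nonempty_iff.1 h
  exact s.ne_zero ⟨0, hN⟩ (Subtype.ext (funext fun _ => funext fun x => isEmptyElim x))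

theorem slaterNorm_nonneg (s : Module.Basis (Fin N) ℂ (sections n k X)) (φ : SmoothMetric n X)
    (x : Fin N → X) : 0 ≤ slaterNorm s φ x := by
  unfold slaterNorm
  positivity

theorem slaterNorm_sq (s : Module.Basis (Fin N) ℂ (sections n k X)) (φ : SmoothMetric n X)
    (x : Fin N → X) :
    ((slaterNorm s φ x ^ 2 : ℝ) : ℂ) = ∑ σ : Equiv.Perm (Fin N), ∑ τ : Equiv.Perm (Fin N),
      ((Equiv.Perm.sign σ : ℤ) : ℂ) * ((Equiv.Perm.sign τ : ℤ) : ℂ)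
        * ∏ j, pairing φ (s (σ j)) (s (τ j)) (x j) := by
  have hexp : (∏ j, Real.exp (-(k * φ.weight (chart (x j)) (x j)) / 2)) ^ 2
      = ∏ j, Real.exp (-(k * φ.weight (chart (x j)) (x j))) := by
    rw [← Finset.prod_pow]
    refine Finset.prod_congr rfl fun j _ => ?_
    rw [← Real.exp_nat_mul]
    congr 1
    push_cast
    ring
  rw [slaterNorm, mul_pow, hexp]
  push_cast
  rw [← Complex.mul_conj', Matrix.det_apply', map_sum, Finset.sum_mul_sum, Finset.sum_mul]
  refine Finset.sum_congr rfl fun σ _ => ?_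
  rw [Finset.sum_mul]
  refine Finset.sum_congr rfl fun τ _ => ?_
  simp only [pairing, Finset.prod_mul_distrib, map_mul, map_prod, map_intCast, Matrix.of_apply,
    Complex.ofReal_exp]
  push_cast
  ring

theorem continuous_slaterNorm [IsManifold 𝓘(ℂ, Fin n → ℂ) ω X]
    (s : Module.Basis (Fin N) ℂ (sections n k X)) (φ : SmoothMetric n X) :
    Continuous (slaterNorm s φ) := by
  have h : slaterNorm s φ = fun x => √(∑ σ : Equiv.Perm (Fin N), ∑ τ : Equiv.Perm (Fin N),
      ((Equiv.Perm.sign σ : ℤ) : ℂ) * ((Equiv.Perm.sign τ : ℤ) : ℂ)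
        * ∏ j, pairing φ (s (σ j)) (s (τ j)) (x j)).re := by
    funext x
    rw [← slaterNorm_sq, Complex.ofReal_re, Real.sqrt_sq (slaterNorm_nonneg s φ x)]
  rw [h]
  have hp := fun i j => continuous_pairing φ (s i) (s j)
  fun_prop

theorem slaterNorm_sq_eq_mul_exp (s : Module.Basis (Fin N) ℂ (sections n k X))
    (φ φ₀ : SmoothMetric n X) (x : Fin N → X) :
    slaterNorm s φ x ^ 2
      = slaterNorm s φ₀ x ^ 2 * Real.exp (-(k * ∑ j, φ.diff φ₀ (x j))) := by
  simp only [slaterNorm, mul_pow, mul_assoc]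
  congr 1
  rw [← Finset.prod_pow, ← Finset.prod_pow, Finset.mul_sum, ← Finset.sum_neg_distrib,
    Real.exp_sum, ← Finset.prod_mul_distrib]
  refine Finset.prod_congr rfl fun j _ => ?_
  rw [← Real.exp_nat_mul, ← Real.exp_nat_mul, ← Real.exp_add, SmoothMetric.diff]
  congr 1
  push_cast
  ring

variable [MeasurableSpace X] [BorelSpace X]

theorem integral_volumeForm_twist (γ : ℝ) (φ φ₀ : SmoothMetric n X) (F : X → ℂ) :
    ∫ x, F x ∂(SmoothMetric.twist γ φ φ₀).volumeForm
      = ∫ x, F x * (Real.exp (-(γ * φ.diff φ₀ x)) : ℂ) ∂φ₀.volumeForm := by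
  have := (φ.continuous_diff φ₀).measurable
  rw [φ.volumeForm_twist, integral_withDensity_eq_integral_toReal_smul (by fun_prop)
    (.of_forall fun _ => ENNReal.ofReal_lt_top)]
  refine integral_congr_ae (.of_forall fun x => ?_)
  simp only [ENNReal.toReal_ofReal (Real.exp_pos _).le, Complex.real_smul]
  ring

variable [CompactSpace X] [IsManifold 𝓘(ℂ, Fin n → ℂ) ω X]

theorem integral_prod_exp_neg_diff (γ : ℝ) (φ φ₀ : SmoothMetric n X) :
    ∫ x : Fin N → X, ∏ j, Real.exp (-(γ * φ.diff φ₀ (x j))) ∂(Measure.pi fun _ => φ₀.volumeForm)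
      = (SmoothMetric.twist γ φ φ₀).volumeForm.real Set.univ ^ N := by
  have := φ₀.isFiniteMeasure_volumeForm
  have h := integral_volumeForm_twist γ φ φ₀ fun _ => 1
  simp only [integral_const, one_mul, integral_complex_ofReal] at h
  have h' : (SmoothMetric.twist γ φ φ₀).volumeForm.real Set.univ
      = ∫ x, Real.exp (-(γ * φ.diff φ₀ x)) ∂φ₀.volumeForm := by
    simpa [← Complex.ofReal_inj] using h
  rw [integral_fintype_prod_eq_pow (fun x => Real.exp (-(γ * φ.diff φ₀ x))), h',
    Fintype.card_fin]

/-- Andréief's identity: the squared norm of the Slater determinant integrates to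
`N! det H^{(k)}`. -/
theorem integral_slaterNorm_sq (s : Module.Basis (Fin N) ℂ (sections n k X)) (γ : ℝ)
    (φ φ₀ : SmoothMetric n X) :
    Integrable (fun x : Fin N → X => slaterNorm s φ x ^ 2
        * ∏ j, Real.exp (-(γ * φ.diff φ₀ (x j)))) (Measure.pi fun _ => φ₀.volumeForm) ∧
    ∫ x : Fin N → X, slaterNorm s φ x ^ 2 * ∏ j, Real.exp (-(γ * φ.diff φ₀ (x j)))
        ∂(Measure.pi fun _ => φ₀.volumeForm)
      = N.factorial * detHermitian s φ (SmoothMetric.twist γ φ φ₀).volumeForm := by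
  have := φ₀.isFiniteMeasure_volumeForm
  set u : X → ℂ := fun x => (Real.exp (-(γ * φ.diff φ₀ x)) : ℂ)
  have hu : Continuous u := by
    have := φ.continuous_diff φ₀
    fun_prop
  have hint : ∀ σ τ : Equiv.Perm (Fin N), Integrable (fun x : Fin N → X =>
      ((Equiv.Perm.sign σ : ℤ) : ℂ) * ((Equiv.Perm.sign τ : ℤ) : ℂ)
        * ∏ j, (pairing φ (s (σ j)) (s (τ j)) (x j) * u (x j)))
      (Measure.pi fun _ => φ₀.volumeForm) := fun σ τ =>
    (Integrable.fintype_prod (f := fun j x => pairing φ (s (σ j)) (s (τ j)) x * u x) fun j =>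
      ((continuous_pairing φ _ _).mul hu).integrable_of_hasCompactSupport
        (HasCompactSupport.of_compactSpace _)).const_mul _
  have heq : (fun x : Fin N → X => ((slaterNorm s φ x ^ 2
        * ∏ j, Real.exp (-(γ * φ.diff φ₀ (x j))) : ℝ) : ℂ))
      = fun x => ∑ σ : Equiv.Perm (Fin N), ∑ τ : Equiv.Perm (Fin N),
        ((Equiv.Perm.sign σ : ℤ) : ℂ) * ((Equiv.Perm.sign τ : ℤ) : ℂ)
          * ∏ j, (pairing φ (s (σ j)) (s (τ j)) (x j) * u (x j)) := by
    funext x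
    rw [Complex.ofReal_mul, slaterNorm_sq, Complex.ofReal_prod]
    simp only [Finset.sum_mul, Finset.prod_mul_distrib, mul_assoc, u]
  have hI : Integrable (fun x : Fin N → X => ((slaterNorm s φ x ^ 2
        * ∏ j, Real.exp (-(γ * φ.diff φ₀ (x j))) : ℝ) : ℂ))
      (Measure.pi fun _ => φ₀.volumeForm) := by
    rw [heq]
    exact integrable_finsetSum _ fun σ _ => integrable_finsetSum _ fun τ _ => hint σ τ
  refine ⟨hI.re, ?_⟩
  have hC : ((∫ x : Fin N → X, slaterNorm s φ x ^ 2 * ∏ j, Real.exp (-(γ * φ.diff φ₀ (x j)))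
        ∂(Measure.pi fun _ => φ₀.volumeForm) : ℝ) : ℂ)
      = N.factorial * Matrix.det (Matrix.of fun i j =>
        hermitianForm φ (SmoothMetric.twist γ φ φ₀).volumeForm (s i) (s j)) := by
    rw [← integral_complex_ofReal, heq, integral_finsetSum _ fun σ _ =>
      integrable_finsetSum _ fun τ _ => hint σ τ]
    have hfac := Matrix.sum_perm_sum_perm_prod (Matrix.of fun i j =>
        hermitianForm φ (SmoothMetric.twist γ φ φ₀).volumeForm (s i) (s j))
    rw [Fintype.card_fin] at hfac
    rw [← hfac]
    refine Finset.sum_congr rfl fun σ _ => ?_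
    rw [integral_finsetSum _ fun τ _ => hint σ τ]
    refine Finset.sum_congr rfl fun τ _ => ?_
    rw [integral_const_mul, integral_fintype_prod_eq_prod
      (fun j x => pairing φ (s (σ j)) (s (τ j)) x * u x)]
    simp only [Matrix.of_apply, hermitianForm, integral_volumeForm_twist, u]
  rw [detHermitian, ← Complex.ofReal_re (∫ _, _ ∂_), hC, ← Complex.ofReal_natCast,
    Complex.re_ofReal_mul]

/-! ### Hölder's inequality -/

/-- The inequality `M ^ N ≤ Z ^ (1 / (1 + p)) (N! det H) ^ (p / (1 + p))` with `p = γ / k`, where `M`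
is the mass of `exp (-(γ φ + (1 - γ) φ₀))`: it is Hölder's inequality for the powers `-p` and `1` of
`‖det S‖²_{kφ}` and the `N`-fold product of this volume form. -/
theorem volume_pow_le (s : Module.Basis (Fin N) ℂ (sections n k X)) {γ : ℝ} (hγ : 0 < γ)
    (hk : 0 < k) (φ φ₀ : SmoothMetric n X) (hZ : partitionFunction s φ₀ (-γ) ≠ ⊤) :
    ENNReal.ofReal ((SmoothMetric.twist γ φ φ₀).volumeForm.real Set.univ ^ N)
      ≤ partitionFunction s φ₀ (-γ) ^ (1 / (1 + γ / k))
        * ENNReal.ofReal (N.factorial * detHermitian s φ (SmoothMetric.twist γ φ φ₀).volumeForm)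
          ^ ((γ / k) / (1 + γ / k)) := by
  have := φ₀.isFiniteMeasure_volumeForm
  have := ChartedSpace.secondCountable_of_sigmaCompact (Fin n → ℂ) X
  have hk' : (0 : ℝ) < k := by exact_mod_cast hk
  obtain ⟨hI, hIeq⟩ := integral_slaterNorm_sq s γ φ φ₀
  have hdiff := φ.continuous_diff φ₀
  have hA : Measurable fun x : Fin N → X =>
      ENNReal.ofReal (slaterNorm s φ₀ x) ^ (2 * -γ / k) := by
    have := (continuous_slaterNorm s φ₀).measurable
    fun_prop
  have hB : Measurable fun x : Fin N → X => ENNReal.ofReal (slaterNorm s φ x ^ 2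
      * ∏ j, Real.exp (-(γ * φ.diff φ₀ (x j)))) := by
    have h1 := continuous_slaterNorm s φ
    have : Continuous fun x : Fin N → X => slaterNorm s φ x ^ 2
      * ∏ j, Real.exp (-(γ * φ.diff φ₀ (x j))) := by fun_prop
    exact this.measurable.ennreal_ofReal
  have hu : Integrable (fun x : Fin N → X => ∏ j, Real.exp (-(γ * φ.diff φ₀ (x j))))
      (Measure.pi fun _ => φ₀.volumeForm) :=
    Integrable.fintype_prod (f := fun _ x => Real.exp (-(γ * φ.diff φ₀ x))) fun _ =>
      Continuous.integrable_of_hasCompactSupport (by fun_prop)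
        (HasCompactSupport.of_compactSpace _)
  rw [← integral_prod_exp_neg_diff, ← hIeq,
    ofReal_integral_eq_lintegral_ofReal hu (.of_forall fun x => by positivity),
    ofReal_integral_eq_lintegral_ofReal hI (.of_forall fun x => by positivity)]
  -- As `Z` is finite, the negative power of the norm is finite almost everywhere, so that the norm
  -- is nonzero almost everywhere and its powers cancel in the product.
  have hfin := ae_lt_top hA hZ
  have hconj : (1 + γ / k).HolderConjugate ((1 + γ / k) / (γ / k)) := by
    rw [Real.holderConjugate_iff]
    have : 0 < γ / k := by positivity
    refine ⟨by linarith, ?_⟩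
    field_simp
  have hH := ENNReal.lintegral_mul_le_Lp_mul_Lq (Measure.pi fun _ => φ₀.volumeForm) hconj
    (hA.pow_const (1 / (1 + γ / k))).aemeasurable
    (hB.pow_const ((γ / k) / (1 + γ / k))).aemeasurable
  have hp : (1 : ℝ) + γ / k ≠ 0 := by positivity
  have hp' : γ / k ≠ 0 := by positivity
  have e1 : 2 * -γ / k * (1 / (1 + γ / k)) * (1 + γ / k) = 2 * -γ / k := by field_simp
  have e2 : (γ / k) / (1 + γ / k) * ((1 + γ / k) / (γ / k)) = 1 := by field_simp
  simp only [← ENNReal.rpow_mul, e1, e2, ENNReal.rpow_one, one_div_div] at hH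
  refine le_trans (lintegral_mono_ae ?_) hH
  filter_upwards [hfin] with x hx
  have hpos : 0 < slaterNorm s φ₀ x := by
    refine (slaterNorm_nonneg s φ₀ x).lt_of_ne fun h0 => hx.ne ?_
    rw [← h0, ENNReal.ofReal_zero]
    refine ENNReal.zero_rpow_of_neg (div_neg_of_neg_of_pos (by linarith) hk')
  refine le_of_eq ?_
  have hexp : ∏ j, Real.exp (-(γ * φ.diff φ₀ (x j)))
      = Real.exp (-(γ * ∑ j, φ.diff φ₀ (x j))) := by
    rw [← Real.exp_sum, Finset.sum_neg_distrib, Finset.mul_sum]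
  rw [Pi.mul_apply, slaterNorm_sq_eq_mul_exp s φ φ₀, hexp]
  obtain ⟨a, ha⟩ : ∃ a, slaterNorm s φ₀ x = Real.exp a := ⟨_, (Real.exp_log hpos).symm⟩
  rw [ha, ENNReal.ofReal_rpow_of_pos (Real.exp_pos _), ← Real.exp_nat_mul, ← Real.exp_add,
    ← Real.exp_add, ENNReal.ofReal_rpow_of_pos (Real.exp_pos _), ← Real.exp_mul, ← Real.exp_mul,
    ← ENNReal.ofReal_mul (by positivity), ← Real.exp_add]
  congr 2
  push_cast
  field_simp
  ring

/-- The inequality for a single metric `φ`, in logarithmic form. -/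
theorem log_partitionFunction_le [Nonempty X] (s : Module.Basis (Fin N) ℂ (sections n k X))
    {γ : ℝ} (hγ : 0 < γ) (hk : 0 < k) (hN : 0 < N) (φ φ₀ : SmoothMetric n X)
    (hZ : partitionFunction s φ₀ (-γ) ≠ ⊤) :
    partitionFunction s φ₀ (-γ) ≠ 0 ∧
    -(1 / (γ * N)) * Real.log (partitionFunction s φ₀ (-γ)).toReal
      ≤ (1 + γ / k) * functionalD s φ₀ γ φ + 1 / (k * N) * Real.log N.factorial := by
  have hk' : (0 : ℝ) < k := by exact_mod_cast hk
  have hN' : (0 : ℝ) < N := by exact_mod_cast hN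
  have := (SmoothMetric.twist γ φ φ₀).isFiniteMeasure_volumeForm
  have hM : 0 < (SmoothMetric.twist γ φ φ₀).volumeForm.real Set.univ :=
    ENNReal.toReal_pos (SmoothMetric.volumeForm_univ_ne_zero _) (measure_ne_top _ _)
  have hle := volume_pow_le s hγ hk φ φ₀ hZ
  have hf : (0 : ℝ) < N.factorial := by exact_mod_cast N.factorial_pos
  unfold functionalD functionalL
  set M := (SmoothMetric.twist γ φ φ₀).volumeForm.real Set.univ
  set Z := partitionFunction s φ₀ (-γ)
  set d := detHermitian s φ (SmoothMetric.twist γ φ φ₀).volumeForm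
  have hq : 0 < 1 / (1 + γ / k) := by positivity
  have hr : 0 < (γ / k) / (1 + γ / k) := by positivity
  have hMN : 0 < ENNReal.ofReal (M ^ N) := ENNReal.ofReal_pos.2 (by positivity)
  have hZ0 : Z ≠ 0 := fun h => by
    rw [h, ENNReal.zero_rpow_of_pos hq, zero_mul] at hle
    exact absurd hle (not_le.2 hMN)
  have hd : 0 < N.factorial * d := by
    by_contra h
    rw [ENNReal.ofReal_of_nonpos (not_lt.1 h), ENNReal.zero_rpow_of_pos hr, mul_zero] at hle
    exact absurd hle (not_le.2 hMN)
  have hd' : 0 < d := pos_of_mul_pos_right hd hf.le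
  refine ⟨hZ0, ?_⟩
  have hz : 0 < Z.toReal := ENNReal.toReal_pos hZ0 hZ
  rw [← ENNReal.ofReal_toReal hZ, ENNReal.ofReal_rpow_of_pos hz, ENNReal.ofReal_rpow_of_pos hd,
    ← ENNReal.ofReal_mul (by positivity), ENNReal.ofReal_le_ofReal_iff (by positivity)] at hle
  have hlog := Real.log_le_log (by positivity) hle
  rw [Real.log_pow, Real.log_mul (by positivity) (by positivity), Real.log_rpow hz,
    Real.log_rpow hd, Real.log_mul hf.ne' hd'.ne'] at hlog
  have key : (1 + γ / k) * (-(-(1 / (N * (k + γ))) * Real.log d) - 1 / γ * Real.log M)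
      + 1 / (k * N) * Real.log N.factorial - -(1 / (γ * N)) * Real.log Z.toReal
      = (1 + γ / k) / (γ * N) * (1 / (1 + γ / k) * Real.log Z.toReal
        + (γ / k) / (1 + γ / k) * (Real.log N.factorial + Real.log d) - N * Real.log M) := by
    field_simp
    ring
  have : 0 ≤ (1 + γ / k) / (γ * N) * (1 / (1 + γ / k) * Real.log Z.toReal
        + (γ / k) / (1 + γ / k) * (Real.log N.factorial + Real.log d) - N * Real.log M) :=
    mul_nonneg (by positivity) (by linarith)
  linarith

end Slater

end Fano

theorem proposition2p2 {n : ℕ} {X : Type*} [TopologicalSpace X] [T2Space X] [CompactSpace X]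
    [ChartedSpace (Fin n → ℂ) X] [IsManifold 𝓘(ℂ, Fin n → ℂ) ω X]
    [MeasurableSpace X] [BorelSpace X]
    (ψ₀ : Fano.SmoothMetric n X) (hψ₀ : ψ₀.HasPositiveCurvature)
    (φ₀ : Fano.SmoothMetric n X) (γ : ℝ) (hγ : 0 < γ)
    (k : ℕ) (hk : 0 < k) (N : ℕ) (hN : 0 < N)
    (s : Module.Basis (Fin N) ℂ (Fano.sections n k X))
    (hs : ∀ i j, Fano.hermitianForm ψ₀ ψ₀.volumeForm (s i) (s j) = if i = j then 1 else 0) :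
    ((-(1 / (γ * N)) : ℝ) : EReal) * ENNReal.log (Fano.partitionFunction s φ₀ (-γ))
      ≤ ((1 + γ / k : ℝ) : EReal)
          * (⨅ φ : Fano.SmoothMetric n X, (Fano.functionalD s φ₀ γ φ : EReal))
        + ((1 / (k * N) * Real.log (Nat.factorial N) : ℝ) : EReal) := by
  have := Fano.nonempty_of_basis s hN
  have hk' : (0 : ℝ) < k := by exact_mod_cast hk
  have hN' : (0 : ℝ) < N := by exact_mod_cast hN
  by_cases hZ : Fano.partitionFunction s φ₀ (-γ) = ⊤
  · rw [hZ, ENNReal.log_top, EReal.coe_mul_top_of_neg (neg_neg_of_pos (by positivity))]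
    exact bot_le
  have hφ := fun φ => Fano.log_partitionFunction_le s hγ hk hN φ φ₀ hZ
  have ha : (0 : ℝ) < 1 + γ / k := by positivity
  rw [ENNReal.log_pos_real (hφ φ₀).1 hZ, ← EReal.coe_mul]
  set L := -(1 / (γ * N)) * Real.log (Fano.partitionFunction s φ₀ (-γ)).toReal
  set c := 1 / (k * N) * Real.log (Nat.factorial N)
  -- The left-hand side is finite here, so the inequality can be solved for the infimum.
  have hinf : (((L - c) / (1 + γ / k) : ℝ) : EReal)
      ≤ ⨅ φ : Fano.SmoothMetric n X, (Fano.functionalD s φ₀ γ φ : EReal) := by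
    refine le_iInf fun φ => EReal.coe_le_coe_iff.2 ?_
    rw [div_le_iff₀ ha]
    linarith [(hφ φ).2]
  calc (L : EReal) = ((1 + γ / k : ℝ) : EReal) * (((L - c) / (1 + γ / k) : ℝ) : EReal)
        + (c : EReal) := by
        rw [← EReal.coe_mul, ← EReal.coe_add, mul_div_cancel₀ _ ha.ne', sub_add_cancel]
    _ ≤ _ := by
        gcongr
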